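/- Let $\mathbb D$ be the open unit disk in $\mathbb C$ and let $\mathcal A$ be a commutative unital complex Banach algebra with $\|1_{\mathcal A}\|=1$. Let $\{F_t\}_{t\ge 0}$ be a one-parameter continuous semigroup of holomorphic self-mappings of $\mathbb D$: $(t,z)\mapsto F_t(z)$ is continuous on $[0,\infty)\times\mathbb D$, $F_{t+s}=F_t\circ F_s$ for all $t,s\ge0$, and $F_0(z)=z$. Suppose that $z_0\in\mathbb D$ is an attractive fixed point, i.e. $F_t(z_0)=z_0$ for all $t\ge 0$ and $F_t(z)\to z_0$ as $t\to\infty$ for all $z$ in some neighbourhood of $z_0$. Let $\{\Gamma_t\}_{t\ge0}$ be an $\mathcal A$-valued semicocycle over $\{F_t\}$: each $\Gamma_t:\mathbb D\to\mathcal A$ is holomorphic, $(t,z)\mapsto\Gamma_t(z)$ is continuous on $[0,\infty)\times\mathbb D$, $\Gamma_t(F_s(z))\Gamma_s(z)=\Gamma_{t+s}(z)$ for all $t,s\ge 0$ and $z\in\mathbb D$, and $\Gamma_0(z)=1_{\mathcal A}$. Then the (one-sided) derivative $B(z)=\frac{d}{dt}\Gamma_t(z)\big|_{t=0}$ exists for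 every $z\in\mathbb D$; with $B_0=B(z_0)$ the integral in $$M(z)=\exp\left[\int_0^\infty\bigl(B(F_t(z))-B_0\bigr)\,dt\right]$$ converges absolutely for every $z\in\mathbb D$; the mapping $M$ is holomorphic on all of $\mathbb D$ with invertible values; and $$\Gamma_t(z)=M(F_t(z))^{-1}e^{tB_0}M(z)\qquad\text{for all } t\ge0,\ z\in\mathbb D .$$ In particular, every such semicocycle is linearizable. -/

import Mathlib

open Set Filter Topology MeasureTheory

noncomputable section

namespace HolSemicocycle

/-- The open unit disk of the complex plane. -/
def disk : Set ℂ := Metric.ball (0 : ℂ) 1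

/-- A one-parameter continuous semigroup of holomorphic self-mappings of the unit disk.
Only the values `F t z` with `0 ≤ t` and `z ∈ disk` matter. -/
structure IsSemigroup (F : ℝ → ℂ → ℂ) : Prop where
  mapsTo : ∀ t, 0 ≤ t → MapsTo (F t) disk disk
  holomorphic : ∀ t, 0 ≤ t → DifferentiableOn ℂ (F t) disk
  continuous : ContinuousOn (fun p : ℝ × ℂ => F p.1 p.2) (Ici 0 ×ˢ disk)
  add : ∀ t s, 0 ≤ t → 0 ≤ s → ∀ z ∈ disk, F (t + s) z = F t (F s z)
  zero : ∀ z ∈ disk, F 0 z = z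

/-- A holomorphic semicocycle, with values in the algebra `A`, over the family `F`. -/
structure IsSemicocycle {A : Type*} [NormedRing A] [NormedAlgebra ℂ A]
    (F : ℝ → ℂ → ℂ) (Γ : ℝ → ℂ → A) : Prop where
  holomorphic : ∀ t, 0 ≤ t → DifferentiableOn ℂ (Γ t) disk
  continuous : ContinuousOn (fun p : ℝ × ℂ => Γ p.1 p.2) (Ici 0 ×ˢ disk)
  chain : ∀ t s, 0 ≤ t → 0 ≤ s → ∀ z ∈ disk, Γ t (F s z) * Γ s z = Γ (t + s) z
  zero : ∀ z ∈ disk, Γ 0 z = 1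

/-- `z₀` is an attractive interior fixed point: it is a common fixed point in the disk, and the
trajectories of all points near `z₀` converge to `z₀`. (For semigroups on the disk this is
the same as convergence of all trajectories, and as `Re f'(z₀) < 0` for the generator `f`.) -/
structure IsAttractiveFixedPoint (F : ℝ → ℂ → ℂ) (z₀ : ℂ) : Prop where
  mem : z₀ ∈ disk
  fixed : ∀ t, 0 ≤ t → F t z₀ = z₀
  attractive : ∀ᶠ z in 𝓝 z₀, Tendsto (fun t : ℝ => F t z) atTop (𝓝 z₀)

variable {A : Type*} [NormedRing A] [NormedAlgebra ℂ A]

/-- `B(z) = d/dt Γ_t(z)` at `t = 0`, a one-sided derivative since `t` ranges over `[0, ∞)`. -/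
def generator (Γ : ℝ → ℂ → A) (z : ℂ) : A :=
  derivWithin (fun t : ℝ => Γ t z) (Ici 0) 0

/-- `M(z) = exp ∫_0^∞ (B(F_t(z)) - B(z₀)) dt`. -/
def transferMap (F : ℝ → ℂ → ℂ) (B : ℂ → A) (z₀ : ℂ) (z : ℂ) : A :=
  NormedSpace.exp (∫ t in Ioi (0 : ℝ), (B (F t z) - B z₀))

/-- The pair `M`, `B₀` linearizes `Γ`: the map `M` is holomorphic on the disk with invertible
values, and `Γ_t(z) = M(F_t(z))⁻¹ e^{t B₀} M(z)`. -/
structure IsLinearization (F : ℝ → ℂ → ℂ) (Γ : ℝ → ℂ → A) (M : ℂ → A) (B₀ : A) : Prop where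
  holomorphic : DifferentiableOn ℂ M disk
  isUnit : ∀ z ∈ disk, IsUnit (M z)
  eq : ∀ t, 0 ≤ t → ∀ z ∈ disk,
    Γ t z = Ring.inverse (M (F t z)) * NormedSpace.exp ((t : ℂ) • B₀) * M z

end HolSemicocycle

end

noncomputable section

namespace HolSemicocycle


open ComplexConjugate

/-! Along a trajectory, `Γ` solves the linear equation `d/dt Γ_t(z) = B(F_t(z)) Γ_t(z)`, so in a
commutative algebra `Γ_t(z) = exp ∫_0^t B(F_s(z)) ds` (`IsSemicocycle.eq_exp_integral`). That
exponent is `t B₀` plus the integral defining `M(z)` minus the one defining `M(F_t(z))`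
(`integral_comp_orbit_shift`); exponentiating gives the formula.

Two ingredients remain. Regularity: `Γ` is only assumed continuous in time, but the average `J_τ =
∫_0^τ Γ_s ds` is holomorphic, is invertible near a given point for small `τ`, and satisfies
`J_τ(F_h(z)) Γ_h(z) = ∫_h^{τ+h} Γ_s(z) ds`, which is differentiable in `h`. Solving for `Γ_h` gives
`B` and its holomorphy. The same averaging, applied beforehand to `F`, gives the generator of the
semigroup. Convergence: with `z₀` moved to `0`, a strict Schwarz lemma makes `F_1` a contraction on
smaller disks, so `B(F_t(z)) - B₀` decays exponentially, locally uniformly in `z`. -/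

lemma isOpen_disk : IsOpen disk := Metric.isOpen_ball

lemma mem_disk {z : ℂ} : z ∈ disk ↔ ‖z‖ < 1 := by simp [disk]

/-! ### Disk automorphisms and reduction to the fixed point `0`. -/

/-- The automorphism `w ↦ (w + a) / (1 + ā w)` of the disk, which takes `0` to `a`. -/
def moebius (a w : ℂ) : ℂ := (w + a) / (1 + conj a * w)

lemma norm_conj_mul_lt_one {a w : ℂ} (ha : a ∈ disk) (hw : w ∈ disk) : ‖conj a * w‖ < 1 := by
  rw [mem_disk] at *
  rw [norm_mul, RCLike.norm_conj]
  nlinarith [norm_nonneg a, norm_nonneg w]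

lemma one_add_conj_mul_ne_zero {a w : ℂ} (ha : a ∈ disk) (hw : w ∈ disk) :
    1 + conj a * w ≠ 0 := by
  intro h
  have h1 := norm_conj_mul_lt_one ha hw
  rw [show conj a * w = -1 by linear_combination h] at h1
  simp at h1

lemma moebius_mem_disk {a w : ℂ} (ha : a ∈ disk) (hw : w ∈ disk) : moebius a w ∈ disk := by
  have h0 := one_add_conj_mul_ne_zero ha hw
  rw [mem_disk] at *
  rw [moebius, norm_div, div_lt_one (norm_pos_iff.2 h0)]
  refine lt_of_pow_lt_pow_left₀ 2 (norm_nonneg _) ?_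
  have ha2 : ‖a‖ ^ 2 < 1 := by nlinarith [norm_nonneg a]
  have hw2 : ‖w‖ ^ 2 < 1 := by nlinarith [norm_nonneg w]
  simp only [Complex.sq_norm, Complex.normSq_apply] at *
  simp only [Complex.add_re, Complex.add_im, Complex.mul_re, Complex.mul_im, Complex.conj_re,
    Complex.conj_im, Complex.one_re, Complex.one_im]
  -- Rests on `|1 + ā w|² - |w + a|² = (1 - |a|²)(1 - |w|²)`.
  nlinarith [mul_pos (sub_pos.2 ha2) (sub_pos.2 hw2)]

lemma neg_mem_disk {a : ℂ} (ha : a ∈ disk) : -a ∈ disk := by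
  rw [mem_disk] at *
  rwa [norm_neg]

lemma moebius_neg_moebius {a w : ℂ} (ha : a ∈ disk) (hw : w ∈ disk) :
    moebius (-a) (moebius a w) = w := by
  have h0 := one_add_conj_mul_ne_zero ha hw
  have h1 := one_add_conj_mul_ne_zero (neg_mem_disk ha) (moebius_mem_disk ha hw)
  rw [moebius, div_eq_iff h1]
  rw [moebius, map_neg]
  rw [mul_comm] at h0
  generalize conj a = b at *
  field_simp
  ring

lemma moebius_moebius_neg {a w : ℂ} (ha : a ∈ disk) (hw : w ∈ disk) :
    moebius a (moebius (-a) w) = w := by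
  simpa using moebius_neg_moebius (neg_mem_disk ha) hw

@[simp] lemma moebius_zero (a : ℂ) : moebius a 0 = a := by simp [moebius]

@[simp] lemma moebius_neg_self (a : ℂ) : moebius (-a) a = 0 := by simp [moebius]

lemma differentiableOn_moebius {a : ℂ} (ha : a ∈ disk) :
    DifferentiableOn ℂ (moebius a) disk := by
  intro w hw
  refine DifferentiableAt.differentiableWithinAt ?_
  unfold moebius
  have := one_add_conj_mul_ne_zero ha hw
  fun_prop (disch := assumption)

/-- Transfers decay at `0` back to `a`. The difference is `w (1 - |a|²) / (1 + ā w)`, the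
denominator has modulus at least `1 - |a|`, and `1 - |a|² ≤ 2 (1 - |a|)`. -/
lemma norm_moebius_sub_le {a w : ℂ} (ha : a ∈ disk) (hw : w ∈ disk) :
    ‖moebius a w - a‖ ≤ 2 * ‖w‖ := by
  have h0 := one_add_conj_mul_ne_zero ha hw
  have h1 : moebius a w - a = w * (1 - a * conj a) / (1 + conj a * w) := by
    rw [moebius]
    rw [mul_comm] at h0
    generalize conj a = b at *
    field_simp
    ring
  have h2 : ‖1 - a * conj a‖ = 1 - ‖a‖ ^ 2 := by
    rw [Complex.mul_conj, Complex.normSq_eq_norm_sq, ← Complex.ofReal_one, ← Complex.ofReal_sub,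
      Complex.norm_real, Real.norm_eq_abs, abs_of_nonneg]
    rw [mem_disk] at ha
    nlinarith [norm_nonneg a]
  have h3 : 1 - ‖a‖ ≤ ‖1 + conj a * w‖ := by
    have h4 : ‖(1 : ℂ)‖ ≤ ‖1 + conj a * w‖ + ‖conj a * w‖ := by
      simpa using norm_sub_le (1 + conj a * w) (conj a * w)
    rw [norm_one, norm_mul, RCLike.norm_conj] at h4
    rw [mem_disk] at hw
    nlinarith [norm_nonneg a]
  rw [mem_disk] at ha
  rw [h1, norm_div, norm_mul, h2, div_le_iff₀ (norm_pos_iff.2 h0)]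
  have : 1 - ‖a‖ ^ 2 ≤ 2 * (1 - ‖a‖) := by nlinarith [norm_nonneg a]
  nlinarith [norm_nonneg w, mul_le_mul_of_nonneg_left h3 (norm_nonneg w),
    mul_le_mul_of_nonneg_left this (norm_nonneg w)]

/-- The semigroup `F` in the coordinate of the disk in which `a` becomes the origin. -/
lemma IsSemigroup.moebius_conj {F : ℝ → ℂ → ℂ} (hF : IsSemigroup F) {a : ℂ} (ha : a ∈ disk) :
    IsSemigroup fun t w => moebius (-a) (F t (moebius a w)) where
  mapsTo t ht w hw :=
    moebius_mem_disk (neg_mem_disk ha) (hF.mapsTo t ht (moebius_mem_disk ha hw))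
  holomorphic t ht :=
    (differentiableOn_moebius (neg_mem_disk ha)).comp
      ((hF.holomorphic t ht).comp (differentiableOn_moebius ha) fun _ hw => moebius_mem_disk ha hw)
      fun _ hw => hF.mapsTo t ht (moebius_mem_disk ha hw)
  continuous := by
    refine (differentiableOn_moebius (neg_mem_disk ha)).continuousOn.comp
      (t := disk) (hF.continuous.comp (f := fun p : ℝ × ℂ => (p.1, moebius a p.2)) ?_ ?_) ?_
    · exact continuousOn_fst.prodMk ((differentiableOn_moebius ha).continuousOn.comp
        continuousOn_snd fun p hp => hp.2)
    · exact fun p hp => ⟨hp.1, moebius_mem_disk ha hp.2⟩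
    · exact fun p hp => hF.mapsTo _ hp.1 (moebius_mem_disk ha hp.2)
  add t s ht hs w hw := by
    rw [moebius_moebius_neg ha (hF.mapsTo s hs (moebius_mem_disk ha hw)),
      hF.add t s ht hs _ (moebius_mem_disk ha hw)]
  zero w hw := by
    rw [hF.zero _ (moebius_mem_disk ha hw), moebius_neg_moebius ha hw]

lemma IsAttractiveFixedPoint.moebius_conj {F : ℝ → ℂ → ℂ} {a : ℂ}
    (ha : IsAttractiveFixedPoint F a) :
    IsAttractiveFixedPoint (fun t w => moebius (-a) (F t (moebius a w))) 0 where
  mem := by simp [mem_disk]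
  fixed t ht := by simp [ha.fixed t ht]
  attractive := by
    have h1 : ContinuousAt (moebius a) 0 :=
      (differentiableOn_moebius ha.mem).continuousOn.continuousAt
      (isOpen_disk.mem_nhds (by simp [mem_disk]))
    have h2 : ContinuousAt (moebius (-a)) a :=
      (differentiableOn_moebius (neg_mem_disk ha.mem)).continuousOn.continuousAt
        (isOpen_disk.mem_nhds ha.mem)
    have h3 : Tendsto (moebius a) (𝓝 0) (𝓝 a) := by simpa using h1.tendsto
    filter_upwards [h3.eventually ha.attractive] with w hw
    simpa [Function.comp_def] using h2.tendsto.comp hw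

/-! ### Exponential attraction from the Schwarz lemma. -/

lemma IsSemigroup.nat_succ {F : ℝ → ℂ → ℂ} (hF : IsSemigroup F) (n : ℕ) {z : ℂ}
    (hz : z ∈ disk) : F (n + 1 : ℕ) z = F 1 (F n z) := by
  rw [Nat.cast_succ, add_comm, hF.add 1 n zero_le_one n.cast_nonneg z hz]

/-- A strict form of the Schwarz lemma for the time-one map. -/
lemma exists_norm_le_mul_of_attractive {G : ℝ → ℂ → ℂ} (hG : IsSemigroup G)
    (h0 : IsAttractiveFixedPoint G 0) {r : ℝ} (hr0 : 0 ≤ r) (hr : r < 1) :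
    ∃ q, 0 ≤ q ∧ q < 1 ∧ ∀ w, ‖w‖ ≤ r → ‖G 1 w‖ ≤ q * ‖w‖ := by
  have hd : DifferentiableOn ℂ (G 1) (Metric.ball 0 1) := hG.holomorphic 1 zero_le_one
  have h10 : G 1 0 = 0 := h0.fixed 1 zero_le_one
  have hm : MapsTo (G 1) (Metric.ball 0 1) (Metric.closedBall (G 1 0) 1) := by
    rw [h10]
    exact (hG.mapsTo 1 zero_le_one).mono_right Metric.ball_subset_closedBall
  have hsub : Metric.closedBall (0 : ℂ) r ⊆ Metric.ball 0 1 :=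
    Metric.closedBall_subset_ball hr
  have hc : ContinuousOn (fun w => ‖dslope (G 1) 0 w‖) (Metric.closedBall 0 r) :=
    (((Complex.differentiableOn_dslope (Metric.ball_mem_nhds 0 one_pos)).2 hd).continuousOn.mono
      hsub).norm
  obtain ⟨w₁, hw₁, hmax⟩ := (isCompact_closedBall (0 : ℂ) r).exists_isMaxOn
    ⟨0, by simpa using hr0⟩ hc
  refine ⟨‖dslope (G 1) 0 w₁‖, norm_nonneg _, ?_, fun w hw => ?_⟩
  · have hle := Complex.norm_dslope_le_div_of_mapsTo_ball hd hm (hsub hw₁)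
    rw [div_one] at hle
    -- Equality in the Schwarz lemma would make `G 1` a rotation, so integer-time orbits would keep
    -- their norm and could not tend to `0`.
    refine lt_of_le_of_ne hle fun heq => ?_
    have haff := Complex.affine_of_mapsTo_ball_of_norm_dslope_eq_div hd hm (hsub hw₁)
      (by rw [heq, div_one])
    have hiso : ∀ w ∈ disk, ‖G 1 w‖ = ‖w‖ := fun w hw => by
      rw [haff hw]
      simp [h10, heq]
    have hiter : ∀ w ∈ disk, ∀ n : ℕ, ‖G n w‖ = ‖w‖ := fun w hw n => by
      induction n with
      | zero => rw [Nat.cast_zero, hG.zero w hw]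
      | succ n ih => rw [hG.nat_succ n hw, hiso _ (hG.mapsTo n n.cast_nonneg hw), ih]
    have hev : ∀ᶠ w in 𝓝[≠] (0 : ℂ), Tendsto (fun t : ℝ => G t w) atTop (𝓝 0) ∧ w ∈ disk :=
      (h0.attractive.and (isOpen_disk.mem_nhds h0.mem)).filter_mono nhdsWithin_le_nhds
    obtain ⟨w, ⟨hw, hwd⟩, hw0⟩ := (hev.and eventually_mem_nhdsWithin).exists
    have h1 := (hw.comp tendsto_natCast_atTop_atTop).norm
    simp only [Function.comp_def, hiter w hwd, norm_zero] at h1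
    exact hw0 (norm_eq_zero.1 (tendsto_nhds_unique tendsto_const_nhds h1))
  · have h1 : G 1 w = w * dslope (G 1) 0 w := by
      simpa [h10] using (sub_smul_dslope (G 1) 0 w).symm
    rw [h1, norm_mul, mul_comm]
    exact mul_le_mul_of_nonneg_right (hmax (by simpa using hw)) (norm_nonneg _)

/-- The time-one contraction is iterated `⌊t⌋` times without leaving the `r`-ball; the leftover time
costs nothing, since a self-map fixing `0` does not increase norms. -/
lemma exists_norm_le_pow_mul_of_attractive {G : ℝ → ℂ → ℂ} (hG : IsSemigroup G)
    (h0 : IsAttractiveFixedPoint G 0) {r : ℝ} (hr0 : 0 ≤ r) (hr : r < 1) :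
    ∃ q, 0 ≤ q ∧ q < 1 ∧ ∀ t, 0 ≤ t → ∀ w, ‖w‖ ≤ r → ‖G t w‖ ≤ q ^ ⌊t⌋₊ * ‖w‖ := by
  obtain ⟨q, hq0, hq1, hq⟩ := exists_norm_le_mul_of_attractive hG h0 hr0 hr
  refine ⟨q, hq0, hq1, fun t ht w hw => ?_⟩
  have hwd : w ∈ disk := mem_disk.2 (hw.trans_lt hr)
  have hnat : ∀ n : ℕ, ‖G n w‖ ≤ q ^ n * ‖w‖ := fun n => by
    induction n with
    | zero => simp [hG.zero w hwd]
    | succ n ih =>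
      rw [hG.nat_succ n hwd]
      refine (hq _ (ih.trans ?_)).trans ?_
      · exact (mul_le_of_le_one_left (norm_nonneg _) (pow_le_one₀ hq0 hq1.le)).trans hw
      · rw [pow_succ', mul_assoc]
        exact mul_le_mul_of_nonneg_left ih hq0
  have hfr : 0 ≤ t - ⌊t⌋₊ := sub_nonneg.2 (Nat.floor_le ht)
  have h1 : G t w = G (t - ⌊t⌋₊) (G ⌊t⌋₊ w) := by
    rw [← hG.add _ _ hfr (Nat.cast_nonneg _) w hwd, sub_add_cancel]
  rw [h1]
  refine le_trans ?_ (hnat _)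
  exact Complex.norm_le_norm_of_mapsTo_ball (hG.holomorphic _ hfr)
    ((hG.mapsTo _ hfr).mono_right Metric.ball_subset_closedBall) (h0.fixed _ hfr)
    (mem_disk.1 (hG.mapsTo _ (Nat.cast_nonneg _) hwd))

/-- On compact sets the trajectories stay in a compact set and approach the attractive fixed
point exponentially fast. -/
lemma exists_norm_sub_le_pow_of_attractive {F : ℝ → ℂ → ℂ} (hF : IsSemigroup F) {z₀ : ℂ}
    (h0 : IsAttractiveFixedPoint F z₀) {K : Set ℂ} (hK : IsCompact K) (hKd : K ⊆ disk) :
    ∃ K' q, IsCompact K' ∧ K' ⊆ disk ∧ 0 ≤ q ∧ q < 1 ∧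
      ∀ t, 0 ≤ t → ∀ z ∈ K, F t z ∈ K' ∧ ‖F t z - z₀‖ ≤ 2 * q ^ ⌊t⌋₊ := by
  have hz₀ := h0.mem
  obtain ⟨r, hr0, hr1, hr⟩ : ∃ r : ℝ, 0 ≤ r ∧ r < 1 ∧ ∀ z ∈ K, ‖moebius (-z₀) z‖ ≤ r := by
    rcases K.eq_empty_or_nonempty with rfl | hne
    · exact ⟨0, le_rfl, one_pos, by simp⟩
    · obtain ⟨z, hz, hmax⟩ := hK.exists_isMaxOn hne
        ((differentiableOn_moebius (neg_mem_disk hz₀)).continuousOn.mono hKd).norm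
      exact ⟨_, norm_nonneg _, mem_disk.1 (moebius_mem_disk (neg_mem_disk hz₀) (hKd hz)), hmax⟩
  obtain ⟨q, hq0, hq1, hq⟩ := exists_norm_le_pow_mul_of_attractive (hF.moebius_conj hz₀)
    h0.moebius_conj hr0 hr1
  have hsub : Metric.closedBall (0 : ℂ) r ⊆ disk := Metric.closedBall_subset_ball hr1
  refine ⟨moebius z₀ '' Metric.closedBall 0 r, q,
    (isCompact_closedBall _ _).image_of_continuousOn
      ((differentiableOn_moebius hz₀).continuousOn.mono hsub), ?_, hq0, hq1, fun t ht z hz => ?_⟩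
  · rintro _ ⟨w, hw, rfl⟩
    exact moebius_mem_disk hz₀ (hsub hw)
  · have h1 := hq t ht _ (hr z hz)
    rw [moebius_moebius_neg hz₀ (hKd hz)] at h1
    have hFd := hF.mapsTo t ht (hKd hz)
    have hpow : q ^ ⌊t⌋₊ ≤ 1 := pow_le_one₀ hq0 hq1.le
    have hw1 := hr z hz
    refine ⟨⟨moebius (-z₀) (F t z), ?_, moebius_moebius_neg hz₀ hFd⟩, ?_⟩
    · rw [mem_closedBall_zero_iff]
      exact (h1.trans (mul_le_of_le_one_left (norm_nonneg _) hpow)).trans hw1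
    · have h2 := norm_moebius_sub_le hz₀ (moebius_mem_disk (neg_mem_disk hz₀) hFd)
      rw [moebius_moebius_neg hz₀ hFd] at h2
      refine h2.trans (mul_le_mul_of_nonneg_left (h1.trans ?_) zero_le_two)
      exact mul_le_of_le_one_right (pow_nonneg hq0 _) (hw1.trans hr1.le)


/-! ### Time integrals depending on a complex parameter. -/

lemma continuousOn_time {E : Type*} [TopologicalSpace E] {G : ℝ → ℂ → E}
    (hc : ContinuousOn (fun p : ℝ × ℂ => G p.1 p.2) (Ici 0 ×ˢ disk)) {z : ℂ} (hz : z ∈ disk) :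
    ContinuousOn (fun s => G s z) (Ici 0) :=
  hc.comp (continuousOn_id.prodMk continuousOn_const) fun _ hs => ⟨hs, hz⟩

lemma intervalIntegrable_time {E : Type*} [NormedAddCommGroup E] {G : ℝ → ℂ → E}
    (hc : ContinuousOn (fun p : ℝ × ℂ => G p.1 p.2) (Ici 0 ×ˢ disk)) {z : ℂ} (hz : z ∈ disk)
    {a b : ℝ} (ha : 0 ≤ a) (hb : 0 ≤ b) :
    IntervalIntegrable (fun s => G s z) volume a b :=
  ((continuousOn_time hc hz).mono fun _ hs => le_trans (le_min ha hb) hs.1).intervalIntegrable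

lemma exists_norm_sub_zero_le {E : Type*} [NormedAddCommGroup E] {G : ℝ → ℂ → E}
    (hc : ContinuousOn (fun p : ℝ × ℂ => G p.1 p.2) (Ici 0 ×ˢ disk))
    {K : Set ℂ} (hK : IsCompact K) (hKd : K ⊆ disk) {ε : ℝ} (hε : 0 < ε) :
    ∃ δ > 0, ∀ s ∈ Icc 0 δ, ∀ z ∈ K, ‖G s z - G 0 z‖ ≤ ε := by
  have huc : UniformContinuousOn (fun p : ℝ × ℂ => G p.1 p.2) (Icc 0 1 ×ˢ K) :=
    (isCompact_Icc.prod hK).uniformContinuousOn_of_continuous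
      (hc.mono (prod_mono (fun s (hs : s ∈ Icc 0 1) => hs.1) hKd))
  obtain ⟨δ, hδ, h⟩ := Metric.uniformContinuousOn_iff_le.1 huc ε hε
  refine ⟨min δ 1, lt_min hδ one_pos, fun s hs z hz => ?_⟩
  rw [← dist_eq_norm]
  refine h (s, z) ⟨⟨hs.1, hs.2.trans (min_le_right _ _)⟩, hz⟩ (0, z) ⟨by simp, hz⟩ ?_
  rw [Prod.dist_eq, dist_self, Real.dist_eq, sub_zero, abs_of_nonneg hs.1]
  exact max_le (hs.2.trans (min_le_left _ _)) hδ.le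

section Integral

variable {E : Type*} [NormedAddCommGroup E] [NormedSpace ℂ E]

/-- An integral depending on a complex parameter is holomorphic, if the integrand is holomorphic
in the parameter and is locally dominated. -/
lemma differentiableOn_integral_of_locally_dominated {α : Type*} [MeasurableSpace α]
    {μ : Measure α} {U : Set ℂ} (hU : IsOpen U) {G : ℂ → α → E}
    (hmeas : ∀ z ∈ U, AEStronglyMeasurable (G z) μ)
    (hdiff : ∀ᵐ a ∂μ, DifferentiableOn ℂ (fun z => G z a) U)
    (hbound : ∀ z ∈ U, ∃ V ∈ 𝓝 z, ∃ b : α → ℝ, Integrable b μ ∧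
      ∀ᵐ a ∂μ, ∀ w ∈ V, ‖G w a‖ ≤ b a) :
    DifferentiableOn ℂ (fun z => ∫ a, G z a ∂μ) U := by
  intro z hz
  obtain ⟨V, hV, b, hb, hle⟩ := hbound z hz
  obtain ⟨ε, hε, hsub⟩ := Metric.nhds_basis_closedBall.mem_iff.1 (inter_mem hV (hU.mem_nhds hz))
  have hball : ∀ w ∈ Metric.ball z (ε / 2),
      Metric.closedBall w (ε / 2) ⊆ Metric.closedBall z ε := by
    intro w hw
    refine Metric.closedBall_subset_closedBall' ?_
    linarith [Metric.mem_ball.1 hw]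
  have hderiv : ∀ᵐ a ∂μ, HasDerivAt (fun w => G w a) (deriv (fun w => G w a) z) z :=
    hdiff.mono fun a ha => (ha.differentiableAt (hU.mem_nhds hz)).hasDerivAt
  classical
  -- The derivative is an a.e. limit of slopes, replaced by `0` off `U` so that each one is
  -- measurable.
  have hmeas' : AEStronglyMeasurable (fun a => deriv (fun w => G w a) z) μ := by
    refine aestronglyMeasurable_of_tendsto_ae (𝓝[≠] z)
      (f := fun w a => if w ∈ U then slope (fun w => G w a) z w else 0) (fun w => ?_) ?_
    · by_cases hw : w ∈ U
      · simp only [hw, if_true, slope_def_module]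
        exact ((hmeas w hw).sub (hmeas z hz)).const_smul _
      · simp only [hw, if_false]
        exact aestronglyMeasurable_const
    · filter_upwards [hderiv] with a ha
      refine (hasDerivAt_iff_tendsto_slope.1 ha).congr' ?_
      filter_upwards [nhdsWithin_le_nhds (hU.mem_nhds hz)] with w hw
      simp [hw]
  refine DifferentiableAt.differentiableWithinAt
    (hasDerivAt_integral_of_dominated_loc_of_deriv_le (F' := fun w a => deriv (fun w => G w a) w)
      (bound := fun a => b a / (ε / 2)) (Metric.ball_mem_nhds z (half_pos hε)) ?_ ?_ hmeas'
      ?_ (hb.div_const _) ?_).2.differentiableAt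
  · filter_upwards [hU.mem_nhds hz] with w hw using hmeas w hw
  · exact hb.mono' (hmeas z hz) (hle.mono fun a ha => ha z (mem_of_mem_nhds hV))
  · filter_upwards [hle, hdiff] with a ha hd w hw
    -- Cauchy's estimate on circles of radius `ε / 2` turns the bound on `G` into one on its
    -- derivative.
    refine Complex.norm_deriv_le_of_forall_mem_sphere_norm_le (half_pos hε) ?_ fun u hu => ?_
    · exact (hd.mono fun u hu => (hsub (hball w hw hu)).2).diffContOnCl_ball subset_rfl
    · exact ha u (hsub (hball w hw (Metric.sphere_subset_closedBall hu))).1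
  · filter_upwards [hdiff] with a ha w hw
    exact (ha.differentiableAt (hU.mem_nhds
      (hsub (hball w hw (Metric.mem_closedBall_self (half_pos hε).le))).2)).hasDerivAt

variable {G : ℝ → ℂ → E}

lemma differentiableOn_intervalIntegral
    (hc : ContinuousOn (fun p : ℝ × ℂ => G p.1 p.2) (Ici 0 ×ˢ disk))
    (hd : ∀ t, 0 ≤ t → DifferentiableOn ℂ (G t) disk) {τ : ℝ} (hτ : 0 ≤ τ) :
    DifferentiableOn ℂ (fun z => ∫ s in (0 : ℝ)..τ, G s z) disk := by
  simp only [intervalIntegral.integral_of_le hτ]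
  refine differentiableOn_integral_of_locally_dominated isOpen_disk (fun z hz => ?_) ?_ ?_
  · exact ((continuousOn_time hc hz).mono fun s hs => hs.1.le).aestronglyMeasurable
      measurableSet_Ioc
  · exact (ae_restrict_iff' measurableSet_Ioc).2 (ae_of_all _ fun s hs => hd s hs.1.le)
  · intro z hz
    obtain ⟨ε, hε, hsub⟩ := Metric.nhds_basis_closedBall.mem_iff.1 (isOpen_disk.mem_nhds hz)
    obtain ⟨C, hC⟩ := (isCompact_Icc.prod (isCompact_closedBall z ε)).exists_bound_of_continuousOn
      (hc.mono (prod_mono (fun s (hs : s ∈ Icc 0 τ) => hs.1) hsub))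
    refine ⟨_, Metric.closedBall_mem_nhds z hε, fun _ => C, integrable_const _, ?_⟩
    exact (ae_restrict_iff' measurableSet_Ioc).2 (ae_of_all _ fun s hs w hw =>
      hC (s, w) ⟨⟨hs.1.le, hs.2⟩, hw⟩)

/-- Short averages are close to the initial value, which is what makes them invertible in the two
uses below. -/
lemma exists_norm_intervalIntegral_sub_le [CompleteSpace E]
    (hc : ContinuousOn (fun p : ℝ × ℂ => G p.1 p.2) (Ici 0 ×ˢ disk))
    {K : Set ℂ} (hK : IsCompact K) (hKd : K ⊆ disk) {ε : ℝ} (hε : 0 < ε) :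
    ∃ δ > 0, ∀ τ ∈ Icc 0 δ, ∀ z ∈ K, ‖(∫ s in (0 : ℝ)..τ, G s z) - τ • G 0 z‖ ≤ ε * τ := by
  obtain ⟨δ, hδ, h⟩ := exists_norm_sub_zero_le hc hK hKd hε
  refine ⟨δ, hδ, fun τ hτ z hz => ?_⟩
  have h1 : (∫ s in (0 : ℝ)..τ, G s z) - τ • G 0 z = ∫ s in (0 : ℝ)..τ, (G s z - G 0 z) := by
    rw [intervalIntegral.integral_sub (intervalIntegrable_time hc (hKd hz) le_rfl hτ.1)
      intervalIntegrable_const, intervalIntegral.integral_const, sub_zero]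
  rw [h1]
  refine (intervalIntegral.norm_integral_le_of_norm_le_const (C := ε) fun s hs => ?_).trans ?_
  · rw [uIoc_of_le hτ.1] at hs
    exact h s ⟨hs.1.le, hs.2.trans hτ.2⟩ z hz
  · rw [sub_zero, abs_of_nonneg hτ.1]

lemma hasDerivWithinAt_intervalIntegral [CompleteSpace E] {g : ℝ → E}
    (hg : ContinuousOn g (Ici 0)) {a : ℝ} (ha : 0 ≤ a) :
    HasDerivWithinAt (fun h => ∫ s in (0 : ℝ)..h, g s) (g a) (Ici a) a := by
  have hga : ContinuousWithinAt g (Ici a) a :=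
    (hg a ha).mono (Ici_subset_Ici.2 ha)
  refine intervalIntegral.integral_hasDerivWithinAt_right ?_ (t := Ioi a) ?_
    (hga.mono Ioi_subset_Ici_self)
  · exact (hg.mono fun s hs => le_trans (le_min le_rfl ha) hs.1).intervalIntegrable
  · exact ⟨Ioi a, self_mem_nhdsWithin, (hg.mono fun s (hs : a < s) =>
      ha.trans hs.le).aestronglyMeasurable measurableSet_Ioi⟩

/-- Right derivative at `0` of a moving average. -/
lemma hasDerivWithinAt_intervalIntegral_sub [CompleteSpace E] {g : ℝ → E}
    (hg : ContinuousOn g (Ici 0)) {τ : ℝ} (hτ : 0 ≤ τ) :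
    HasDerivWithinAt (fun h => ∫ s in h..τ + h, g s) (g τ - g 0) (Ici 0) 0 := by
  have h1 : HasDerivWithinAt (fun h => ∫ s in (0 : ℝ)..τ + h, g s) (g τ) (Ici 0) 0 := by
    have h2 : HasDerivWithinAt (fun h : ℝ => τ + h) 1 (Ici 0) 0 :=
      ((hasDerivAt_id (0 : ℝ)).const_add τ).hasDerivWithinAt
    have h3 := HasDerivWithinAt.scomp_of_eq (h := fun h : ℝ => τ + h) (t' := Ici τ)
      (0 : ℝ) (hasDerivWithinAt_intervalIntegral hg hτ) h2
      (fun h (hh : 0 ≤ h) => by simpa using hh) (by simp)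
    simpa [Function.comp_def] using h3
  refine (h1.sub (hasDerivWithinAt_intervalIntegral hg le_rfl)).congr (fun h hh => ?_) ?_
  · have hi : ∀ b, 0 ≤ b → IntervalIntegrable g volume 0 b := fun b hb =>
      (hg.mono fun s hs => le_trans (le_min le_rfl hb) hs.1).intervalIntegrable
    exact (intervalIntegral.integral_interval_sub_left (hi _ (add_nonneg hτ hh)) (hi _ hh)).symm
  · simp

end Integral

/-! ### The generator of the semigroup. -/

/-- The slope of `I ∘ φ` is the slope of `φ` times `dslope I (φ 0) (φ h)`, whose limit is nonzero.
Using `dslope` allows `φ h = φ 0`. -/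
lemma hasDerivWithinAt_of_comp_left {I : ℂ → ℂ} {φ : ℝ → ℂ} {D : ℂ}
    (hφ : ContinuousWithinAt φ (Ici 0) 0) (hI : DifferentiableAt ℂ I (φ 0))
    (hI0 : deriv I (φ 0) ≠ 0) (hD : HasDerivWithinAt (fun h => I (φ h)) D (Ici 0) 0) :
    HasDerivWithinAt φ (D / deriv I (φ 0)) (Ici 0) 0 := by
  rw [hasDerivWithinAt_iff_tendsto_slope] at hD ⊢
  have h1 : Tendsto (fun h => dslope I (φ 0) (φ h)) (𝓝[Ici 0 \ {0}] 0) (𝓝 (deriv I (φ 0))) := by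
    have h2 := (continuousAt_dslope_same.2 hI).tendsto
    rw [dslope_same] at h2
    exact h2.comp (hφ.tendsto.mono_left (nhdsWithin_mono _ sdiff_subset))
  refine (hD.div h1 hI0).congr' ?_
  filter_upwards [h1.eventually_ne hI0] with h hh
  have h3 := sub_smul_dslope I (φ 0) (φ h)
  rw [Pi.div_apply, div_eq_iff hh, slope_def_module, slope_def_module, ← h3, smul_eq_mul, smul_mul_assoc]

lemma IsSemigroup.continuousOn_orbit {F : ℝ → ℂ → ℂ} (hF : IsSemigroup F) {z : ℂ}
    (hz : z ∈ disk) : ContinuousOn (fun t => F t z) (Ici 0) :=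
  continuousOn_time hF.continuous hz

/-- For small `τ` the integral differs from `τ w` by at most `r τ / 2` on a circle of radius `r`, so
by Cauchy its derivative is within `τ / 2` of `τ`. -/
lemma IsSemigroup.exists_deriv_integral_ne_zero {F : ℝ → ℂ → ℂ} (hF : IsSemigroup F) {z : ℂ}
    (hz : z ∈ disk) :
    ∃ τ, 0 < τ ∧ deriv (fun w => ∫ s in (0 : ℝ)..τ, F s w) z ≠ 0 := by
  obtain ⟨r, hr, hsub⟩ := Metric.nhds_basis_closedBall.mem_iff.1 (isOpen_disk.mem_nhds hz)
  obtain ⟨τ, hτ, h⟩ := exists_norm_intervalIntegral_sub_le hF.continuous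
    (isCompact_closedBall z r) hsub (half_pos hr)
  refine ⟨τ, hτ, fun h0 => ?_⟩
  have hdI := differentiableOn_intervalIntegral hF.continuous hF.holomorphic hτ.le
  have hd : DifferentiableOn ℂ (fun w => (∫ s in (0 : ℝ)..τ, F s w) - τ * w) disk :=
    hdI.sub (differentiableOn_id.const_mul _)
  have h1 := Complex.norm_deriv_le_of_forall_mem_sphere_norm_le hr
    ((hd.mono hsub).diffContOnCl_ball subset_rfl) (C := r / 2 * τ) fun w hw => by
      have hw' := Metric.sphere_subset_closedBall hw
      have := h τ ⟨hτ.le, le_rfl⟩ w hw'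
      rwa [hF.zero w (hsub hw'), Complex.real_smul] at this
  have h2 : deriv (fun w => (∫ s in (0 : ℝ)..τ, F s w) - τ * w) z = -τ := by
    have h3 := ((hdI.differentiableAt (isOpen_disk.mem_nhds hz)).hasDerivAt.sub
      ((hasDerivAt_id' z).const_mul (τ : ℂ))).deriv
    rw [h0, zero_sub, mul_one] at h3
    exact h3
  rw [h2, norm_neg, Complex.norm_real, Real.norm_eq_abs, abs_of_pos hτ,
    show r / 2 * τ / r = τ / 2 by field_simp] at h1
  linarith

/-- A continuous semigroup of holomorphic maps is differentiable in time, and its generator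
is holomorphic. -/
lemma IsSemigroup.exists_generator {F : ℝ → ℂ → ℂ} (hF : IsSemigroup F) :
    ∃ f : ℂ → ℂ, DifferentiableOn ℂ f disk ∧
      ∀ z ∈ disk, HasDerivWithinAt (fun t => F t z) (f z) (Ici 0) 0 := by
  set I : ℝ → ℂ → ℂ := fun τ w => ∫ s in (0 : ℝ)..τ, F s w with hIdef
  have hI : ∀ τ, 0 ≤ τ → DifferentiableOn ℂ (I τ) disk := fun τ hτ =>
    differentiableOn_intervalIntegral hF.continuous hF.holomorphic hτ
  -- By the semigroup law `I τ (F h w) = ∫_h^{τ+h} F s w ds`, with right derivative `F τ w - w` at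
  -- `h = 0`.
  have key : ∀ τ, 0 < τ → ∀ w ∈ disk, deriv (I τ) w ≠ 0 →
      HasDerivWithinAt (fun t => F t w) ((F τ w - w) / deriv (I τ) w) (Ici 0) 0 := by
    intro τ hτ w hw h0
    have hz := hF.zero w hw
    have hcomp : HasDerivWithinAt (fun h => I τ (F h w)) (F τ w - F 0 w) (Ici 0) 0 := by
      refine (hasDerivWithinAt_intervalIntegral_sub (hF.continuousOn_orbit hw) hτ.le).congr
        (fun h (hh : 0 ≤ h) => ?_) ?_
      · have h1 : I τ (F h w) = ∫ s in (0 : ℝ)..τ, F (s + h) w := by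
          refine intervalIntegral.integral_congr fun s hs => ?_
          rw [uIcc_of_le hτ.le] at hs
          exact (hF.add s h hs.1 hh w hw).symm
        rw [h1, intervalIntegral.integral_comp_add_right (fun s => F s w), zero_add]
      · simp [I, hz]
    have h2 := hasDerivWithinAt_of_comp_left (φ := fun t => F t w)
      (hF.continuousOn_orbit hw 0 self_mem_Ici)
      (by rw [hz]; exact (hI τ hτ.le).differentiableAt (isOpen_disk.mem_nhds hw))
      (by rwa [hz]) hcomp
    simpa only [hz] using h2
  have hder : ∀ z ∈ disk, DifferentiableWithinAt ℝ (fun t => F t z) (Ici 0) 0 := fun z hz => by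
    obtain ⟨τ, hτ, h0⟩ := hF.exists_deriv_integral_ne_zero hz
    exact (key τ hτ z hz h0).differentiableWithinAt
  refine ⟨fun z => derivWithin (fun t => F t z) (Ici 0) 0, fun z hz => ?_,
    fun z hz => (hder z hz).hasDerivWithinAt⟩
  obtain ⟨τ, hτ, h0⟩ := hF.exists_deriv_integral_ne_zero hz
  have hnhds := isOpen_disk.mem_nhds hz
  have hd' : DifferentiableAt ℂ (deriv (I τ)) z :=
    ((hI τ hτ.le).deriv isOpen_disk).differentiableAt hnhds
  -- The `τ` chosen for `z` also serves nearby points, so one holomorphic quotient represents the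
  -- generator there.
  have hloc : DifferentiableAt ℂ (fun w => (F τ w - w) / deriv (I τ) w) z :=
    (((hF.holomorphic τ hτ.le).differentiableAt hnhds).sub differentiableAt_id).div hd' h0
  refine (hloc.congr_of_eventuallyEq ?_).differentiableWithinAt
  filter_upwards [hnhds, hd'.continuousAt.eventually_ne h0] with w hw hw0
  exact (key τ hτ w hw hw0).derivWithin (uniqueDiffWithinAt_Ici 0)


/-! ### The generator of the semicocycle. -/

section Semicocycle

variable {A : Type*} [NormedCommRing A] [NormedAlgebra ℂ A]
  [CompleteSpace A] {F : ℝ → ℂ → ℂ} {Γ : ℝ → ℂ → A}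

/-- For small `τ`, `τ⁻¹ J` is within `1/2` of `1`, hence invertible by the Neumann series. -/
lemma IsSemicocycle.exists_isUnit_integral [NormOneClass A] (hΓ : IsSemicocycle F Γ) {z : ℂ}
    (hz : z ∈ disk) : ∃ τ, 0 < τ ∧ IsUnit (∫ s in (0 : ℝ)..τ, Γ s z) := by
  obtain ⟨τ, hτ, h⟩ := exists_norm_intervalIntegral_sub_le hΓ.continuous
    (isCompact_singleton (x := z)) (singleton_subset_iff.2 hz) one_half_pos
  refine ⟨τ, hτ, ?_⟩
  have h1 := h τ ⟨hτ.le, le_rfl⟩ z rfl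
  rw [hΓ.zero z hz] at h1
  set J := ∫ s in (0 : ℝ)..τ, Γ s z
  have h2 : ‖1 - τ⁻¹ • J‖ < 1 := by
    have h3 : 1 - τ⁻¹ • J = -(τ⁻¹ • (J - τ • (1 : A))) := by
      rw [smul_sub, smul_smul, inv_mul_cancel₀ hτ.ne', one_smul, neg_sub]
    rw [h3, norm_neg, norm_smul, norm_inv, Real.norm_eq_abs, abs_of_pos hτ,
      inv_mul_lt_iff₀ hτ]
    linarith
  have h4 : IsUnit (τ⁻¹ • J) := by
    simpa using isUnit_one_sub_of_norm_lt_one h2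
  have h5 : J = (algebraMap ℝ A τ) * (τ⁻¹ • J) := by
    rw [← Algebra.smul_def, smul_smul, mul_inv_cancel₀ hτ.ne', one_smul]
  rw [h5]
  exact ((isUnit_iff_ne_zero.2 hτ.ne').map (algebraMap ℝ A)).mul h4

/-- Near `0`, `g = K⁻¹ (K g)` is differentiable; the product rule then identifies the derivative. -/
lemma hasDerivWithinAt_of_isUnit_mul {K g : ℝ → A} {K' D : A}
    (hK : HasDerivWithinAt K K' (Ici 0) 0) (hK0 : IsUnit (K 0)) (hg0 : g 0 = 1)
    (hD : HasDerivWithinAt (fun h => K h * g h) D (Ici 0) 0) :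
    HasDerivWithinAt g (Ring.inverse (K 0) * (D - K')) (Ici 0) 0 := by
  obtain ⟨u, hu⟩ := hK0
  have hinv : DifferentiableAt ℝ Ring.inverse (K 0) := by
    rw [← hu]
    exact (hasFDerivAt_ringInverse (𝕜 := ℝ) u).differentiableAt
  have hdiff : DifferentiableWithinAt ℝ g (Ici 0) 0 := by
    refine ((hinv.comp_differentiableWithinAt (0 : ℝ) hK.differentiableWithinAt).mul
      hD.differentiableWithinAt).congr_of_eventuallyEq ?_ ?_
    · have hopen : {a : A | IsUnit a} ∈ 𝓝 (K 0) := Units.isOpen.mem_nhds ⟨u, hu⟩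
      filter_upwards [hK.continuousWithinAt hopen] with h hh
      exact (Ring.inverse_mul_cancel_left _ _ hh).symm
    · exact (Ring.inverse_mul_cancel_left _ _ ⟨u, hu⟩).symm
  have hprod := hK.mul hdiff.hasDerivWithinAt
  have heq : D = K' * g 0 + K 0 * derivWithin g (Ici 0) 0 :=
    (uniqueDiffWithinAt_Ici 0).eq_deriv _ hD hprod
  have hval : Ring.inverse (K 0) * (D - K') = derivWithin g (Ici 0) 0 := by
    rw [heq, hg0, mul_one, add_sub_cancel_left, Ring.inverse_mul_cancel_left _ _ ⟨u, hu⟩]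
  rw [hval]
  exact hdiff.hasDerivWithinAt

/-- A semicocycle is differentiable in time at `0`, and its generator is holomorphic. -/
lemma IsSemicocycle.hasDerivWithinAt_generator_and_differentiableOn [NormOneClass A]
    (hF : IsSemigroup F) (hΓ : IsSemicocycle F Γ) :
    (∀ z ∈ disk, HasDerivWithinAt (fun t => Γ t z) (generator Γ z) (Ici 0) 0) ∧
      DifferentiableOn ℂ (generator Γ) disk := by
  obtain ⟨f, hf, hfd⟩ := hF.exists_generator
  set J : ℝ → ℂ → A := fun τ w => ∫ s in (0 : ℝ)..τ, Γ s w with hJdef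
  have hJ : ∀ τ, 0 ≤ τ → DifferentiableOn ℂ (J τ) disk := fun τ hτ =>
    differentiableOn_intervalIntegral hΓ.continuous hΓ.holomorphic hτ
  -- The chain rule gives `J τ (F h w) * Γ h w = ∫_h^{τ+h} Γ s w ds`. Differentiating `J τ (F h w)`
  -- in `h` is where the generator `f` is needed.
  have key : ∀ τ, 0 < τ → ∀ w ∈ disk, IsUnit (J τ w) →
      HasDerivWithinAt (fun t => Γ t w)
        (Ring.inverse (J τ w) * (Γ τ w - 1 - f w • deriv (J τ) w)) (Ici 0) 0 := by
    intro τ hτ w hw hu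
    have hz := hF.zero w hw
    have hprod : HasDerivWithinAt (fun h => J τ (F h w) * Γ h w) (Γ τ w - Γ 0 w) (Ici 0) 0 := by
      refine (hasDerivWithinAt_intervalIntegral_sub (continuousOn_time hΓ.continuous hw)
        hτ.le).congr (fun h (hh : 0 ≤ h) => ?_) ?_
      · have h1 : J τ (F h w) * Γ h w = ∫ s in (0 : ℝ)..τ, Γ (s + h) w := by
          have h2 := ((ContinuousLinearMap.mul ℝ A).flip (Γ h w)).intervalIntegral_comp_comm
            (intervalIntegrable_time hΓ.continuous (hF.mapsTo h hh hw) le_rfl hτ.le)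
          refine h2.symm.trans ?_
          refine intervalIntegral.integral_congr fun s hs => ?_
          rw [uIcc_of_le hτ.le] at hs
          exact hΓ.chain s h hs.1 hh w hw
        rw [h1, intervalIntegral.integral_comp_add_right (fun s => Γ s w), zero_add]
      · simp [J, hz, hΓ.zero w hw]
    have hJd : HasDerivAt (J τ) (deriv (J τ) w) (F 0 w) := by
      rw [hz]
      exact ((hJ τ hτ.le).differentiableAt (isOpen_disk.mem_nhds hw)).hasDerivAt
    have hcomp : HasDerivWithinAt (fun h => J τ (F h w)) (f w • deriv (J τ) w) (Ici 0) 0 := by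
      have := HasDerivAt.scomp_hasDerivWithinAt (h := fun t => F t w) (0 : ℝ) hJd (hfd w hw)
      exact this
    have h2 := hasDerivWithinAt_of_isUnit_mul (g := fun t => Γ t w) hcomp (by rwa [hz])
      (hΓ.zero w hw) hprod
    simpa only [hz, hΓ.zero w hw] using h2
  refine ⟨fun z hz => ?_, fun z hz => ?_⟩
  · obtain ⟨τ, hτ, hu⟩ := hΓ.exists_isUnit_integral hz
    exact (key τ hτ z hz hu).differentiableWithinAt.hasDerivWithinAt
  · obtain ⟨τ, hτ, hu⟩ := hΓ.exists_isUnit_integral hz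
    have hnhds := isOpen_disk.mem_nhds hz
    have hJz : DifferentiableAt ℂ (J τ) z := (hJ τ hτ.le).differentiableAt hnhds
    have hinv : DifferentiableAt ℂ Ring.inverse (J τ z) := by
      obtain ⟨u, hu'⟩ := hu
      rw [show J τ z = u from hu'.symm]
      exact (hasFDerivAt_ringInverse (𝕜 := ℂ) u).differentiableAt
    have hd' : DifferentiableAt ℂ (deriv (J τ)) z :=
      ((hJ τ hτ.le).deriv isOpen_disk).differentiableAt hnhds
    have hloc : DifferentiableAt ℂ
        (fun w => Ring.inverse (J τ w) * (Γ τ w - 1 - f w • deriv (J τ) w)) z :=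
      (hinv.comp z hJz).mul ((((hΓ.holomorphic τ hτ.le).differentiableAt hnhds).sub_const 1).sub
        ((hf.differentiableAt hnhds).smul hd'))
    refine (hloc.congr_of_eventuallyEq ?_).differentiableWithinAt
    have hopen : {a : A | IsUnit a} ∈ 𝓝 (J τ z) := Units.isOpen.mem_nhds hu
    filter_upwards [hnhds, hJz.continuousAt hopen] with w hw hw0
    exact (key τ hτ w hw hw0).derivWithin (uniqueDiffWithinAt_Ici 0)

end Semicocycle


/-! ### Convergence and holomorphy of the integral defining `M`. -/

/-- Combines `q ≤ exp (q - 1)` with `⌊t⌋₊ > t - 1`; avoiding `log q` covers `q = 0`. -/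
lemma pow_floor_le_exp {q : ℝ} (hq0 : 0 ≤ q) (hq1 : q < 1) (t : ℝ) :
    q ^ ⌊t⌋₊ ≤ Real.exp (1 - q) * Real.exp (-(1 - q) * t) := by
  have h1 : q ≤ Real.exp (q - 1) := by linarith [Real.add_one_le_exp (q - 1)]
  refine (pow_le_pow_left₀ hq0 h1 _).trans ?_
  rw [← Real.exp_nat_mul, ← Real.exp_add, Real.exp_le_exp]
  nlinarith [Nat.lt_floor_add_one t]

section Holomorphic

variable {E : Type*} [NormedAddCommGroup E] [NormedSpace ℂ E]
  {F : ℝ → ℂ → ℂ} {z₀ : ℂ} {B : ℂ → E}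

/-- Exponential decay of `B (F t z) - B z₀`, uniformly on compact sets. -/
lemma exists_integrable_bound [CompleteSpace E] (hF : IsSemigroup F)
    (h0 : IsAttractiveFixedPoint F z₀)
    (hB : DifferentiableOn ℂ B disk) {K : Set ℂ} (hK : IsCompact K) (hKd : K ⊆ disk) :
    ∃ b : ℝ → ℝ, IntegrableOn b (Ioi 0) ∧
      ∀ t, 0 ≤ t → ∀ z ∈ K, ‖B (F t z) - B z₀‖ ≤ b t := by
  obtain ⟨K', q, hK', hKd', hq0, hq1, h⟩ := exists_norm_sub_le_pow_of_attractive hF h0 hK hKd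
  -- The `dslope` of `B`, bounded on `K'`, serves as a Lipschitz constant at `z₀`.
  have hds : ContinuousOn (dslope B z₀) K' :=
    ((Complex.differentiableOn_dslope (isOpen_disk.mem_nhds h0.mem)).2 hB).continuousOn.mono hKd'
  obtain ⟨L, hL⟩ := hK'.exists_bound_of_continuousOn hds
  refine ⟨fun t => 2 * (Real.exp (1 - q) * Real.exp (-(1 - q) * t)) * L, ?_, fun t ht z hz => ?_⟩
  · exact (((exp_neg_integrableOn_Ioi 0 (sub_pos.2 hq1)).const_mul _).const_mul _).mul_const _
  · obtain ⟨hmem, hle⟩ := h t ht z hz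
    rw [← sub_smul_dslope, norm_smul]
    have hp := pow_floor_le_exp hq0 hq1 t
    exact mul_le_mul (by linarith) (hL _ hmem) (norm_nonneg _) (by positivity)

lemma continuousOn_comp_orbit_sub (hF : IsSemigroup F) (hB : DifferentiableOn ℂ B disk) {z : ℂ}
    (hz : z ∈ disk) : ContinuousOn (fun t => B (F t z) - B z₀) (Ici 0) :=
  (hB.continuousOn.comp (hF.continuousOn_orbit hz) fun _ ht => hF.mapsTo _ ht hz).sub
    continuousOn_const

lemma integrableOn_comp_orbit_sub [CompleteSpace E] (hF : IsSemigroup F)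
    (h0 : IsAttractiveFixedPoint F z₀)
    (hB : DifferentiableOn ℂ B disk) {z : ℂ} (hz : z ∈ disk) :
    IntegrableOn (fun t => B (F t z) - B z₀) (Ioi 0) := by
  obtain ⟨b, hb, hle⟩ := exists_integrable_bound hF h0 hB (isCompact_singleton (x := z))
    (singleton_subset_iff.2 hz)
  refine hb.mono' (((continuousOn_comp_orbit_sub hF hB hz).mono
    Ioi_subset_Ici_self).aestronglyMeasurable measurableSet_Ioi) ?_
  exact (ae_restrict_iff' measurableSet_Ioi).2 (ae_of_all _ fun t ht => hle t (le_of_lt ht) z rfl)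

lemma differentiableOn_integral_comp_orbit_sub [CompleteSpace E] (hF : IsSemigroup F)
    (h0 : IsAttractiveFixedPoint F z₀) (hB : DifferentiableOn ℂ B disk) :
    DifferentiableOn ℂ (fun z => ∫ t in Ioi (0 : ℝ), (B (F t z) - B z₀)) disk := by
  refine differentiableOn_integral_of_locally_dominated isOpen_disk (fun z hz => ?_) ?_
    fun z hz => ?_
  · exact ((continuousOn_comp_orbit_sub hF hB hz).mono
      Ioi_subset_Ici_self).aestronglyMeasurable measurableSet_Ioi
  · refine (ae_restrict_iff' measurableSet_Ioi).2 (ae_of_all _ fun t (ht : 0 < t) => ?_)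
    exact (hB.comp (hF.holomorphic t ht.le) (hF.mapsTo t ht.le)).sub_const _
  · obtain ⟨ε, hε, hsub⟩ := Metric.nhds_basis_closedBall.mem_iff.1 (isOpen_disk.mem_nhds hz)
    obtain ⟨b, hb, hle⟩ := exists_integrable_bound hF h0 hB (isCompact_closedBall z ε) hsub
    exact ⟨_, Metric.closedBall_mem_nhds z hε, b, hb,
      (ae_restrict_iff' measurableSet_Ioi).2 (ae_of_all _ fun t ht => hle t (le_of_lt ht))⟩

/-- The additive form of the linearization: shifting time by `t` turns the second integral into the
tail over `(t, ∞)`. -/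
lemma integral_comp_orbit_shift [CompleteSpace E] (hF : IsSemigroup F)
    (h0 : IsAttractiveFixedPoint F z₀)
    (hB : DifferentiableOn ℂ B disk) {t : ℝ} (ht : 0 ≤ t) {z : ℂ} (hz : z ∈ disk) :
    (∫ s in Ioi (0 : ℝ), (B (F s z) - B z₀)) - ∫ s in Ioi (0 : ℝ), (B (F s (F t z)) - B z₀) =
      (∫ s in (0 : ℝ)..t, B (F s z)) - t • B z₀ := by
  have h1 : ∫ s in Ioi (0 : ℝ), (B (F s (F t z)) - B z₀) = ∫ s in Ioi t, (B (F s z) - B z₀) := by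
    have h2 := (measurePreserving_add_right volume t).setIntegral_preimage_emb
      (MeasurableEquiv.addRight t).measurableEmbedding (fun s => B (F s z) - B z₀) (Ioi t)
    rw [← h2, preimage_add_const_Ioi, sub_self]
    refine setIntegral_congr_fun measurableSet_Ioi fun s (hs : 0 < s) => ?_
    simp only [hF.add s t hs.le ht z hz]
  have hci : IntervalIntegrable (fun s => B (F s z)) volume 0 t :=
    ((hB.continuousOn.comp (hF.continuousOn_orbit hz) fun _ hs => hF.mapsTo _ hs hz).mono
      fun s hs => le_trans (le_min le_rfl ht) hs.1).intervalIntegrable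
  rw [h1, intervalIntegral.integral_Ioi_sub_Ioi (integrableOn_comp_orbit_sub hF h0 hB hz) ht,
    intervalIntegral.integral_sub hci intervalIntegrable_const, intervalIntegral.integral_const,
    sub_zero]

end Holomorphic

/-! ### The differential equation along trajectories and its solution. -/

section Semicocycle

variable {A : Type*} [NormedCommRing A] [NormedAlgebra ℂ A]
  {F : ℝ → ℂ → ℂ} {Γ : ℝ → ℂ → A} {B : ℂ → A}

/-- For `s ≥ t`, `Γ s z = Γ (s - t) (F t z) * Γ t z`, which moves the derivative at `0` to time `t`.
-/
lemma IsSemicocycle.hasDerivWithinAt_time (hF : IsSemigroup F) (hΓ : IsSemicocycle F Γ)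
    (hB : ∀ z ∈ disk, HasDerivWithinAt (fun t => Γ t z) (B z) (Ici 0) 0) {z : ℂ} (hz : z ∈ disk)
    {t : ℝ} (ht : 0 ≤ t) :
    HasDerivWithinAt (fun s => Γ s z) (B (F t z) * Γ t z) (Ici t) t := by
  have h1 : HasDerivWithinAt (fun s : ℝ => s - t) 1 (Ici t) t :=
    ((hasDerivAt_id t).sub_const t).hasDerivWithinAt
  have h2 := HasDerivWithinAt.scomp_of_eq (h := fun s : ℝ => s - t) (t' := Ici 0) t
    (hB (F t z) (hF.mapsTo t ht hz)) h1 (fun s (hs : t ≤ s) => sub_nonneg.2 hs) (sub_self t).symm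
  rw [one_smul] at h2
  refine (h2.mul_const (Γ t z)).congr (fun s (hs : t ≤ s) => ?_) ?_
  · simp only [Function.comp_apply]
    rw [hΓ.chain (s - t) t (sub_nonneg.2 hs) ht z hz, sub_add_cancel]
  · simp only [Function.comp_apply]
    rw [hΓ.chain (t - t) t (sub_self t).ge ht z hz, sub_add_cancel]

/-- A semicocycle is the exponential of the integral of its generator along trajectories. -/
lemma IsSemicocycle.eq_exp_integral [CompleteSpace A] (hF : IsSemigroup F)
    (hΓ : IsSemicocycle F Γ)
    (hB : ∀ z ∈ disk, HasDerivWithinAt (fun t => Γ t z) (B z) (Ici 0) 0)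
    (hBc : ContinuousOn B disk) {z : ℂ} (hz : z ∈ disk) {t : ℝ} (ht : 0 ≤ t) :
    Γ t z = NormedSpace.exp (∫ s in (0 : ℝ)..t, B (F s z)) := by
  let _ : NormedAlgebra ℚ A := NormedAlgebra.restrictScalars ℚ ℝ A
  have hg : ContinuousOn (fun s => B (F s z)) (Ici 0) :=
    hBc.comp (hF.continuousOn_orbit hz) fun _ hs => hF.mapsTo _ hs hz
  set P : ℝ → A := fun x => ∫ s in (0 : ℝ)..x, B (F s z) with hP
  have hPd : ∀ x, 0 ≤ x → HasDerivWithinAt P (B (F x z)) (Ici x) x := fun x hx =>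
    hasDerivWithinAt_intervalIntegral hg hx
  have hPc : ContinuousOn P (Icc 0 t) := by
    have h1 : IntegrableOn (fun s => B (F s z)) (uIcc 0 t) := by
      rw [uIcc_of_le ht]
      exact (hg.mono fun s hs => hs.1).integrableOn_compact isCompact_Icc
    have := intervalIntegral.continuousOn_primitive_interval h1
    rwa [uIcc_of_le ht] at this
  have hcont : ContinuousOn (fun x => NormedSpace.exp (-P x) * Γ x z) (Icc 0 t) :=
    (NormedSpace.exp_continuous.comp_continuousOn hPc.neg).mul
      ((continuousOn_time hΓ.continuous hz).mono fun s hs => hs.1)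
  -- Integrating factor: `exp (-P) Γ` has zero right derivative, by commutativity, and so keeps its
  -- initial value `1`.
  have hder : ∀ x ∈ Ico 0 t,
      HasDerivWithinAt (fun x => NormedSpace.exp (-P x) * Γ x z) 0 (Ici x) x := by
    intro x hx
    have h1 : HasDerivWithinAt (fun x => NormedSpace.exp (-P x))
        (NormedSpace.exp (-P x) * -B (F x z)) (Ici x) x := by
      have h2 := (hasFDerivAt_exp (𝕂 := ℝ) (x := -P x)).comp_hasDerivWithinAt x
        (hPd x hx.1).neg
      simpa [Function.comp_def] using h2
    have h3 := h1.mul (hΓ.hasDerivWithinAt_time hF hB hz hx.1)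
    convert! h3 using 1
    ring
  have h := constant_of_has_deriv_right_zero hcont hder t ⟨ht, le_rfl⟩
  simp only [hP, intervalIntegral.integral_same, neg_zero, NormedSpace.exp_zero, one_mul,
    hΓ.zero z hz] at h
  have h2 : NormedSpace.exp (P t) * NormedSpace.exp (-P t) = 1 := by
    rw [← NormedSpace.exp_add, add_neg_cancel, NormedSpace.exp_zero]
  calc Γ t z = NormedSpace.exp (P t) * (NormedSpace.exp (-P t) * Γ t z) := by
        rw [← mul_assoc, h2, one_mul]
    _ = NormedSpace.exp (P t) := by rw [h, mul_one]

end Semicocycle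

end HolSemicocycle

end

theorem theorem3p5 {A : Type*} [NormedCommRing A] [NormedAlgebra ℂ A] [NormOneClass A]
    [CompleteSpace A] (F : ℝ → ℂ → ℂ) (hF : HolSemicocycle.IsSemigroup F)
    (z₀ : ℂ) (hz₀ : HolSemicocycle.IsAttractiveFixedPoint F z₀)
    (Γ : ℝ → ℂ → A) (hΓ : HolSemicocycle.IsSemicocycle F Γ) :
    (∀ z ∈ HolSemicocycle.disk,
      HasDerivWithinAt (fun t : ℝ => Γ t z) (HolSemicocycle.generator Γ z) (Set.Ici 0) 0) ∧
    (∀ z ∈ HolSemicocycle.disk,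
      MeasureTheory.IntegrableOn
        (fun t : ℝ => HolSemicocycle.generator Γ (F t z) - HolSemicocycle.generator Γ z₀)
        (Set.Ioi 0)) ∧
    HolSemicocycle.IsLinearization F Γ
      (HolSemicocycle.transferMap F (HolSemicocycle.generator Γ) z₀)
      (HolSemicocycle.generator Γ z₀) := by
  let _ : NormedAlgebra ℚ A := NormedAlgebra.restrictScalars ℚ ℝ A
  obtain ⟨hB, hBd⟩ := hΓ.hasDerivWithinAt_generator_and_differentiableOn hF
  refine ⟨hB, fun z hz => HolSemicocycle.integrableOn_comp_orbit_sub hF hz₀ hBd hz, ?_, ?_, ?_⟩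
  · intro z hz
    exact (hasFDerivAt_exp (𝕂 := ℂ)).differentiableAt.comp_differentiableWithinAt z
      (HolSemicocycle.differentiableOn_integral_comp_orbit_sub hF hz₀ hBd z hz)
  · exact fun z _ => NormedSpace.isUnit_exp _
  · intro t ht z hz
    -- Commutativity merges the exponentials, leaving an additive identity between exponents.
    rw [hΓ.eq_exp_integral hF hB hBd.continuousOn hz ht, HolSemicocycle.transferMap,
      HolSemicocycle.transferMap, Ring.inverse_exp, ← NormedSpace.exp_add, ← NormedSpace.exp_add]
    congr 1
    have h := HolSemicocycle.integral_comp_orbit_shift hF hz₀ hBd ht hz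
    rw [Complex.coe_smul]
    rw [sub_eq_iff_eq_add] at h
    rw [h]
    abel
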